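/- Let $p\ge 1$ be an integer (the case $p\geq 2$ being the one of interest). The Vilenkin group $\tilde G$ is the group of all sequences $x=(x_j)_{j\in\mathbb Z}$ in $\{0,\dots,p-1\}$ with $x_j=0$ for all $j<k(x)$, under coordinatewise addition $\oplus$ modulo $p$. It carries the group topology in which the subgroups $U_l=\{x: x_j=0 \text{ for } j\le l\}$, $l\in\mathbb Z$, form a neighbourhood basis of $0$, and the Haar measure $\mu$ with $\mu(U_0)=1$. The dual group $\tilde G^*$ consists of the same kind of sequences, with the analogous subgroups $U_l^*$, topology and Haar measure $\mu^*$; put $U^*=U^*_0$. The pairing is $\chi(x,\omega)=\exp\bigl(\frac{2\pi i}{p}\sum_{j}x_j\omega_{1-j}\bigr)$. Let $H=\{x\in\tilde G: x_j=0 \text{ for } j>0\}$, and let $H^\perp=\{\omega\in\tilde G^*:\chi(h,\omega)=1 \text{ for all } h\in H\}$. For $f\in L^2(\tilde G)$ let $\hat f\in L^2(\tilde G^*)$ be its Fourier transform, i.e. the $L^2$-limit as $n\to\infty$ of $\omega\mapsto\int_{U_{-n}}f(x)\overline{\chi(x,\omega)}\,d\mu(x)$. For a function $g$ on $\tilde G^*$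 (in particular for a representative of $\hat f$) and $\omega\in\tilde G^*$ let $g_{\Vert\omega}=(g(\omega\oplus h))_{h\in H^\perp}$ be the fiber of $g$ at $\omega$, and put $\mathbb V(g)=\{\omega\in U^*: g_{\Vert\omega}\ne 0\}$ and $P(g)(\omega)=\sum_{h\in H^\perp}|g(\omega\oplus h)|^2\in[0,\infty]$. Up to a $\mu^*$-null set, $\mathbb V_f=\mathbb V(\hat f)$ does not depend on the representative of $\hat f$. For $\phi\in L^2(\tilde G)$ the principal shift-invariant space is $\langle\phi\rangle=\overline{\operatorname{span}}\{\phi(\cdot\ominus h):h\in H\}$. The spectrum $\eta(\mathbb S)$ of a shift-invariant closed subspace $\mathbb S\subseteq L^2(\tilde G)$ is the set of $\omega\in U^*$ at which some $f\in\mathbb S$ has a nonzero fiber $\hat f_{\Vert\omega}$, taken modulo null sets: a set $E\subseteq U^*$ is a version of $\eta(\mathbb S)$ if $\mathbb V_f\subseteq E$ up to a null set for every $f\in\mathbb S$, and if $E\subseteq F$ up to a null set for every set $F\subseteq\tilde G^*$ that contains each $\mathbb V_f$, $f\in\mathbb S$, up to a null set. **Proposition.** Let $\phi\in L^2(\tilde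 G)$, and let $g$ be any representative of $\hat\phi$; write $\mathbb V_\phi=\mathbb V(g)$, $P_\phi=P(g)$ and $\operatorname{supp}P_\phi=\{\omega\in\tilde G^*:P_\phi(\omega)\ne0\}$. Then $$\eta(\langle\phi\rangle)=\mathbb V_\phi=\operatorname{supp}P_\phi\cap U^*,$$ where the first equality holds modulo null sets (a set $E\subseteq U^*$ is a version of $\eta(\langle\phi\rangle)$ if and only if it differs from $\mathbb V_\phi$ by a null set) and the second holds at every point. Moreover, for every countable dense subset $D$ of $\langle\phi\rangle$ and with arbitrary fixed representatives of $\hat f$, $f\in D$, the set $\{\omega\in U^*:\{\hat f_{\Vert\omega}:f\in D\}\ne\{0\}\}$ equals $\mathbb V_\phi$ up to a null set. -/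

import Mathlib

open MeasureTheory Filter Topology
open scoped ENNReal ComplexConjugate

noncomputable section

/-- Two-sided sequences of residues mod `p` which vanish far enough to the left,
as a subgroup of all sequences under coordinatewise addition mod `p`. -/
def vilenkinSubgroup (p : ℕ) : AddSubgroup (ℤ → ZMod p) where
  carrier := {x | ∃ k : ℤ, ∀ j < k, x j = 0}
  zero_mem' := ⟨0, fun _ _ => rfl⟩
  add_mem' := by
    rintro x y ⟨k, hk⟩ ⟨l, hl⟩
    refine ⟨min k l, fun j hj => ?_⟩
    simp [hk j (lt_of_lt_of_le hj (min_le_left _ _)), hl j (lt_of_lt_of_le hj (min_le_right _ _))]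
  neg_mem' := by
    rintro x ⟨k, hk⟩
    exact ⟨k, fun j hj => by simp [hk j hj]⟩

/-- The Vilenkin group. It is a new type, so that it does not carry the
topology induced from the product topology, but the one defined below. -/
def Vilenkin (p : ℕ) : Type := vilenkinSubgroup p

namespace Vilenkin

variable {p : ℕ}

instance : AddCommGroup (Vilenkin p) := inferInstanceAs (AddCommGroup (vilenkinSubgroup p))

/-- The coordinate `x_j` of `x`. -/
def coord (x : Vilenkin p) (j : ℤ) : ZMod p := x.1 j

theorem ext_coord {x y : Vilenkin p} (h : ∀ j, x.coord j = y.coord j) : x = y :=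
  Subtype.ext (funext h)

@[simp] theorem coord_zero (j : ℤ) : (0 : Vilenkin p).coord j = 0 := rfl

@[simp] theorem coord_add (x y : Vilenkin p) (j : ℤ) :
    (x + y).coord j = x.coord j + y.coord j := rfl

@[simp] theorem coord_neg (x : Vilenkin p) (j : ℤ) : (-x).coord j = -x.coord j := rfl

/-- The subgroup `U_l` of all `x` with `x_j = 0` for `j ≤ l`. -/
def U (p : ℕ) (l : ℤ) : AddSubgroup (Vilenkin p) where
  carrier := {x | ∀ j ≤ l, x.coord j = 0}
  zero_mem' := fun _ _ => rfl
  add_mem' := fun {x y} hx hy j hj => by simp [hx j hj, hy j hj]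
  neg_mem' := fun {x} hx j hj => by simp [hx j hj]

theorem mem_U {l : ℤ} {x : Vilenkin p} : x ∈ U p l ↔ ∀ j ≤ l, x.coord j = 0 := Iff.rfl

/-- The sets `U_l` as a basis of neighbourhoods of zero. -/
@[reducible] def filterBasis (p : ℕ) : AddGroupFilterBasis (Vilenkin p) where
  sets := {s | ∃ l : ℤ, s = (U p l : Set (Vilenkin p))}
  nonempty := ⟨_, 0, rfl⟩
  inter_sets := by
    rintro _ _ ⟨k, rfl⟩ ⟨l, rfl⟩
    exact ⟨_, ⟨max k l, rfl⟩, fun x hx =>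
      ⟨fun j hj => hx j (hj.trans (le_max_left _ _)),
        fun j hj => hx j (hj.trans (le_max_right _ _))⟩⟩
  zero' := by
    rintro _ ⟨l, rfl⟩
    exact (U p l).zero_mem
  add' := by
    rintro _ ⟨l, rfl⟩
    refine ⟨_, ⟨l, rfl⟩, ?_⟩
    rintro _ ⟨x, hx, y, hy, rfl⟩
    exact (U p l).add_mem hx hy
  neg' := by
    rintro _ ⟨l, rfl⟩
    exact ⟨_, ⟨l, rfl⟩, fun x hx => (U p l).neg_mem hx⟩
  conj' := by
    rintro x _ ⟨l, rfl⟩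
    exact ⟨_, ⟨l, rfl⟩, fun y hy => by simpa using hy⟩

/-- The topology in which the sets `U_l + x` form a neighbourhood basis of `x`. -/
instance : TopologicalSpace (Vilenkin p) := (filterBasis p).topology

instance : IsTopologicalAddGroup (Vilenkin p) := (filterBasis p).isTopologicalAddGroup

instance : MeasurableSpace (Vilenkin p) := borel _

instance : BorelSpace (Vilenkin p) := ⟨rfl⟩

theorem U_mem_nhds_zero (l : ℤ) : (U p l : Set (Vilenkin p)) ∈ 𝓝 (0 : Vilenkin p) :=
  (filterBasis p).mem_nhds_zero ⟨l, rfl⟩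

theorem isOpen_U (l : ℤ) : IsOpen (U p l : Set (Vilenkin p)) :=
  (U p l).isOpen_of_mem_nhds (U_mem_nhds_zero l)

/-- Cut a sequence off to the left of coordinate `1`. -/
def cutOff (y : ℤ → ZMod p) : Vilenkin p :=
  ⟨fun j => if j ≤ 0 then 0 else y j, 0, fun _ hj => if_pos hj.le⟩

theorem isCompact_U_zero [NeZero p] : IsCompact (U p 0 : Set (Vilenkin p)) := by
  let _ : TopologicalSpace (ZMod p) := ⊥
  have _ : DiscreteTopology (ZMod p) := ⟨rfl⟩
  have hc : Continuous (cutOff : (ℤ → ZMod p) → Vilenkin p) := by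
    rw [continuous_iff_continuousAt]
    intro y
    rw [ContinuousAt, ((filterBasis p).nhds_hasBasis _).tendsto_right_iff]
    rintro _ ⟨l, rfl⟩
    have h : ∀ᶠ z in 𝓝 y, ∀ j ∈ Finset.Icc 1 l, z j = y j := by
      rw [Filter.eventually_all_finset]
      intro j _
      exact (continuous_apply j).continuousAt.eventually
        ((isOpen_discrete {y j}).mem_nhds rfl)
    filter_upwards [h] with z hz
    refine ⟨cutOff z - cutOff y, fun j hj => ?_, by simp⟩
    change (if j ≤ 0 then 0 else z j) - (if j ≤ 0 then 0 else y j) = 0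
    split_ifs with h0
    · simp
    · rw [hz j (Finset.mem_Icc.2 ⟨by omega, hj⟩), sub_self]
  have hr : (U p 0 : Set (Vilenkin p)) = Set.range cutOff := by
    ext x
    constructor
    · intro hx
      refine ⟨x.coord, ext_coord fun j => ?_⟩
      change (if j ≤ 0 then 0 else x.coord j) = x.coord j
      split_ifs with h0
      · exact (hx j h0).symm
      · rfl
    · rintro ⟨y, rfl⟩ j hj
      exact if_pos hj
  rw [hr]
  exact isCompact_range hc

/-- `U = U_0` as a compact set with nonempty interior. -/
def unitCompact (p : ℕ) [NeZero p] : TopologicalSpace.PositiveCompacts (Vilenkin p) where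
  carrier := U p 0
  isCompact' := isCompact_U_zero
  interior_nonempty' := ⟨0, by
    rw [(isOpen_U 0).interior_eq]
    exact (U p 0).zero_mem⟩

/-- The Haar measure, normalized so that `U_0` has measure `1`. -/
def haar (p : ℕ) [NeZero p] : Measure (Vilenkin p) := Measure.addHaarMeasure (unitCompact p)

instance [NeZero p] : (haar p).IsAddHaarMeasure :=
  inferInstanceAs (Measure.addHaarMeasure (unitCompact p)).IsAddHaarMeasure

/-- The dual group consists of sequences of the same kind, with the same operations,
neighbourhoods and Haar measure; it acts on the group through the pairing `χ`. -/
abbrev Dual (p : ℕ) : Type := Vilenkin p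

/-- The pairing `χ(x, ω) = exp((2πi/p) ∑_j x_j ω_{1-j})`; here `ZMod.stdAddChar` is the map
`a ↦ exp(2πi a/p)`, and only finitely many terms of the sum are nonzero. -/
def χ [NeZero p] (x : Vilenkin p) (ω : Dual p) : ℂ :=
  ZMod.stdAddChar (∑ᶠ j : ℤ, x.coord j * ω.coord (1 - j))

/-- The discrete subgroup `H` of all `x` with `x_j = 0` for `j > 0`. -/
def H (p : ℕ) : Set (Vilenkin p) := {x | ∀ j > 0, x.coord j = 0}

/-- The annihilator `H^⊥` of `H` in the dual group. -/
def Hperp (p : ℕ) [NeZero p] : Set (Dual p) := {ω | ∀ h ∈ H p, χ h ω = 1}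

/-- The Hilbert space `L²` of the Vilenkin group (and of its dual). -/
abbrev L2 (p : ℕ) [NeZero p] : Type := Lp ℂ 2 (haar p)

/-- The translation `T_h f = f(· - h)` on `L²`. -/
def translate [NeZero p] (h : Vilenkin p) (f : L2 p) : L2 p :=
  Lp.compMeasurePreserving (fun x => x - h) (measurePreserving_sub_right (haar p) h) f

/-- The principal shift-invariant space: the closed linear span of the `T_h φ`, `h ∈ H`. -/
def principal [NeZero p] (φ : L2 p) : Submodule ℂ (L2 p) :=
  (Submodule.span ℂ ((fun h => translate h φ) '' H p)).topologicalClosure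

/-- The Fourier integral of `f` over the compact open subgroup `U_{-n}`. These subgroups
increase to the whole group, and an `L²` function is integrable on each of them. -/
def truncatedFourier [NeZero p] (n : ℕ) (f : Vilenkin p → ℂ) (ω : Dual p) : ℂ :=
  ∫ x in (U p (-(n : ℤ)) : Set (Vilenkin p)), f x * conj (χ x ω) ∂(haar p)

/-- `g` is the `L²` Fourier transform of `f`: the truncated Fourier integrals
`∫_{U_{-n}} f(x) conj χ(x, ω) dx` converge to `g` in `L²`. -/
def IsFourier [NeZero p] (f : L2 p) (g : L2 p) : Prop :=
  Tendsto (fun n : ℕ => eLpNorm (fun ω => truncatedFourier n f ω - g ω) 2 (haar p)) atTop (𝓝 0)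

open Classical in
/-- The `L²` (Plancherel) Fourier transform; by Plancherel's theorem the limit always exists. -/
def fourier [NeZero p] (f : L2 p) : L2 p :=
  if h : ∃ g, IsFourier f g then h.choose else 0

/-- The fibre `(g(ω + h))_{h ∈ H^⊥}` of a function on the dual group at `ω`. -/
def fiber [NeZero p] (g : Dual p → ℂ) (ω : Dual p) : Hperp p → ℂ := fun h => g (ω + h)

/-- The periodization `P(ω) = ∑_{h ∈ H^⊥} |g(ω + h)|²`, with values in `[0, ∞]`. -/
def periodization [NeZero p] (g : Dual p → ℂ) (ω : Dual p) : ℝ≥0∞ :=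
  ∑' h : Hperp p, ‖g (ω + h)‖ₑ ^ 2

/-- The set of `ω ∈ U^*` at which the fibre of `g` is nonzero. -/
def fiberSupport [NeZero p] (g : Dual p → ℂ) : Set (Dual p) :=
  {ω | ω ∈ U p 0 ∧ fiber g ω ≠ 0}

/-- The set of fibres at `ω` of the Fourier transforms of the elements of `S`,
where `r f` is the representative in use of the Fourier transform of `f`. -/
def fibers [NeZero p] (r : L2 p → Dual p → ℂ) (S : Set (L2 p)) (ω : Dual p) :
    Set (Hperp p → ℂ) :=
  (fun f => fiber (r f) ω) '' S

/-- `E` is (a version of) the spectrum of `S`, the set of those `ω ∈ U^*` at which some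
`f ∈ S` has a nonzero fibre. Each such set of `ω` is determined by `f` only up to a null set and
`S` is uncountable, so the union over `f ∈ S` is the essential union: the least subset of `U^*`,
up to null sets, which contains, up to null sets, the fibre support of every `f ∈ S`. -/
def IsSpectrum [NeZero p] (S : Submodule ℂ (L2 p)) (E : Set (Dual p)) : Prop :=
  E ⊆ U p 0 ∧
  (∀ f ∈ S, fiberSupport (fourier f) ≤ᵐ[haar p] E) ∧
  ∀ F : Set (Dual p), (∀ f ∈ S, fiberSupport (fourier f) ≤ᵐ[haar p] F) → E ≤ᵐ[haar p] F

end Vilenkin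

end

/-! For a set `Z` in the dual group, the `f` whose transform vanishes a.e. on `Z` form a closed
subspace `vanishing Z`, because the Fourier transform is continuous. Translation of `f` multiplies
its transform by a unimodular factor (`fourier_translate`), so `φ ∈ vanishing Z` forces `principal φ
≤ vanishing Z`. Take for `Z` the zero set of the fibres of `φhat`. It is `H^⊥`-invariant and `H^⊥`
is countable, so vanishing a.e. on `Z` becomes vanishing of a.e. fibre over `Z`
(`ae_fiber_eq_zero`). Hence the fibre support of every `f` in the space lies in that of `φ`; since
`φ` is itself in the space, this bound is least. For a dense `D`, take instead the common zero set
of the fibres of `D`: then `D`, hence its closure, hence `φ`, lies in `vanishing Z`. Of Fourier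
theory only the existence of the `L²` limit and its contractivity are needed. Both come from
Bessel's inequality for characters restricted to `U_{-n}`; Plancherel's identity is not used. -/

namespace Vilenkin

open Pointwise

variable {p : ℕ}

/-! ### Coordinates and the subgroups `U_l` -/

/-- The sequence with the entry `a` at the coordinate `i` and zeros elsewhere. -/
def single (i : ℤ) (a : ZMod p) : Vilenkin p :=
  ⟨(Pi.single i a : ℤ → ZMod p), i, fun _ hj => Pi.single_eq_of_ne (M := fun _ => ZMod p) hj.ne a⟩

theorem coord_single (i : ℤ) (a : ZMod p) (j : ℤ) :
    (single i a).coord j = (Pi.single i a : ℤ → ZMod p) j := rfl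

@[simp] theorem coord_sub (x y : Vilenkin p) (j : ℤ) :
    (x - y).coord j = x.coord j - y.coord j := rfl

theorem single_mem_U {i l : ℤ} (h : l < i) (a : ZMod p) : single i a ∈ U p l := fun j hj => by
  rw [coord_single, Pi.single_eq_of_ne (by omega)]

theorem exists_mem_U (x : Vilenkin p) : ∃ l : ℤ, x ∈ U p l := by
  obtain ⟨k, hk⟩ := x.2
  exact ⟨k - 1, fun j hj => hk j (by omega)⟩

theorem U_anti {k l : ℤ} (h : k ≤ l) : U p l ≤ U p k := fun _ hx j hj => hx j (hj.trans h)

theorem eventually_mem_U (x : Vilenkin p) : ∀ᶠ n : ℕ in atTop, x ∈ U p (-(n : ℤ)) := by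
  obtain ⟨l, hl⟩ := exists_mem_U x
  filter_upwards [eventually_ge_atTop (-l).toNat] with n hn
  exact U_anti (by omega) hl

theorem measurableSet_U (l : ℤ) : MeasurableSet (U p l : Set (Vilenkin p)) :=
  (isOpen_U l).measurableSet

/-- A function which is constant on the cosets of some `U_l` is continuous. -/
theorem continuous_of_forall_add {α : Type*} [TopologicalSpace α] {f : Vilenkin p → α} (l : ℤ)
    (h : ∀ x, ∀ u ∈ U p l, f (x + u) = f x) : Continuous f := by
  refine continuous_iff_continuousAt.2 fun x => ?_
  refine (continuousAt_const (y := f x)).congr ?_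
  have hu : ∀ᶠ y in 𝓝 x, y - x ∈ (U p l : Set (Vilenkin p)) :=
    (continuous_id.sub continuous_const).continuousAt.eventually_mem
      (by simpa using U_mem_nhds_zero l)
  filter_upwards [hu] with y hy
  simpa using (h x _ hy).symm

/-! ### The pairing and annihilators -/

section Pairing

variable [NeZero p]

-- Needed for bi-additivity of `χ`: `∑ᶠ` takes the value 0 on infinite supports. Here one factor
-- vanishes far to the left, the other, being read backwards, far to the right.
omit [NeZero p] in
theorem finite_support_pairing (x : Vilenkin p) (ω : Dual p) :
    (Function.support fun j : ℤ => x.coord j * ω.coord (1 - j)).Finite := by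
  obtain ⟨k, hk⟩ := exists_mem_U x
  obtain ⟨l, hl⟩ := exists_mem_U ω
  refine (Set.finite_Icc k (1 - l)).subset fun j hj => ⟨?_, ?_⟩
  · by_contra h
    exact hj (by simp [hk j (by omega)])
  · by_contra h
    exact hj (by simp [hl (1 - j) (by omega)])

theorem χ_add_left (x y : Vilenkin p) (ω : Dual p) : χ (x + y) ω = χ x ω * χ y ω := by
  simp only [χ, coord_add, add_mul]
  rw [finsum_add_distrib (finite_support_pairing x ω) (finite_support_pairing y ω),
    AddChar.map_add_eq_mul]

theorem χ_add_right (x : Vilenkin p) (ω ν : Dual p) : χ x (ω + ν) = χ x ω * χ x ν := by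
  simp only [χ, coord_add, mul_add]
  rw [finsum_add_distrib (finite_support_pairing x ω) (finite_support_pairing x ν),
    AddChar.map_add_eq_mul]

@[simp] theorem norm_χ (x : Vilenkin p) (ω : Dual p) : ‖χ x ω‖ = 1 := by
  rw [χ, ZMod.stdAddChar_apply, Circle.norm_coe]

theorem conj_χ_mul_self (x : Vilenkin p) (ω : Dual p) : conj (χ x ω) * χ x ω = 1 := by
  rw [mul_comm, Complex.mul_conj, Complex.normSq_eq_norm_sq]
  simp

theorem χ_sub_right (x : Vilenkin p) (ω ν : Dual p) : χ x (ω - ν) = conj (χ x ν) * χ x ω := by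
  have h := χ_add_right x (ω - ν) ν
  rw [sub_add_cancel] at h
  rw [h, mul_comm, mul_assoc, mul_comm (χ x ν), conj_χ_mul_self, mul_one]

theorem χ_eq_one {l : ℤ} {x : Vilenkin p} {ω : Dual p} (hx : x ∈ U p l) (hω : ω ∈ U p (-l)) :
    χ x ω = 1 := by
  have h : ∀ j : ℤ, x.coord j * ω.coord (1 - j) = 0 := fun j => by
    rcases le_or_gt j l with hj | hj
    · simp [hx j hj]
    · simp [hω (1 - j) (by omega)]
  rw [χ, finsum_eq_zero_of_forall_eq_zero h, AddChar.map_zero_eq_one]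

theorem χ_single (i : ℤ) (a : ZMod p) (ω : Dual p) :
    χ (single i a) ω = ZMod.stdAddChar (a * ω.coord (1 - i)) := by
  rw [χ, finsum_eq_single _ i fun j hj => by rw [coord_single, Pi.single_eq_of_ne hj, zero_mul],
    coord_single, Pi.single_eq_same]

theorem coord_eq_zero_of_χ_single {i : ℤ} {ω : Dual p} (h : χ (single (1 - i) 1) ω = 1) :
    ω.coord i = 0 := by
  rw [χ_single, one_mul, sub_sub_cancel, ← AddChar.map_zero_eq_one (ZMod.stdAddChar (N := p))] at h
  exact ZMod.injective_stdAddChar h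

/-- With `χ_eq_one` this makes `U_l` the exact annihilator of `U_{-l}`; a nonzero coordinate `i` is
detected by a sequence concentrated at `1 - i`. -/
theorem exists_χ_ne_one {l : ℤ} {ω : Dual p} (h : ω ∉ U p l) : ∃ x ∈ U p (-l), χ x ω ≠ 1 := by
  simp only [mem_U, not_forall] at h
  obtain ⟨i, hi, hω⟩ := h
  exact ⟨single (1 - i) 1, single_mem_U (by omega) _, fun h => hω (coord_eq_zero_of_χ_single h)⟩

theorem continuous_χ_left (ω : Dual p) : Continuous fun x : Vilenkin p => χ x ω := by
  obtain ⟨l, hl⟩ := exists_mem_U ω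
  refine continuous_of_forall_add (-l) fun x u hu => ?_
  rw [χ_add_left, χ_eq_one hu (by simpa using hl), mul_one]

theorem continuous_χ_right (x : Vilenkin p) : Continuous fun ω : Dual p => χ x ω := by
  obtain ⟨l, hl⟩ := exists_mem_U x
  refine continuous_of_forall_add (-l) fun ω u hu => ?_
  rw [χ_add_right, χ_eq_one hl hu, mul_one]

end Pairing

/-! ### Discrete complements of `U_l` and the group `H^⊥` -/

section Discrete

/-- The subgroup of all `x` with `x_j = 0` for `j > l`; it is a complement of `U_l`. -/
def L (p : ℕ) (l : ℤ) : AddSubgroup (Vilenkin p) where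
  carrier := {x | ∀ j > l, x.coord j = 0}
  zero_mem' := fun _ _ => rfl
  add_mem' := fun {x y} hx hy j hj => by simp [hx j hj, hy j hj]
  neg_mem' := fun {x} hx j hj => by simp [hx j hj]

instance [NeZero p] (l : ℤ) : Countable (L p l) := by
  let f : L p l → ℤ →₀ ZMod p := fun x => Finsupp.ofSupportFinite x.1.coord <| by
    obtain ⟨k, hk⟩ := exists_mem_U x.1
    refine (Set.finite_Icc k l).subset fun j hj => ⟨?_, ?_⟩
    · by_contra h
      exact hj (hk j (by omega))
    · by_contra h
      exact hj (x.2 j (by omega))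
  refine Function.Injective.countable (f := f) fun x y h => Subtype.ext (ext_coord fun j => ?_)
  exact DFunLike.congr_fun h j

theorem eq_zero_of_mem_L_of_mem_U {l : ℤ} {x : Vilenkin p} (hL : x ∈ L p l) (hU : x ∈ U p l) :
    x = 0 :=
  ext_coord fun j => by
    rcases le_or_gt j l with hj | hj
    · exact hU j hj
    · exact hL j hj

/-- The part of a sequence to the right of the coordinate `l`. -/
def tail (l : ℤ) (x : Vilenkin p) : Vilenkin p :=
  ⟨fun j => if j ≤ l then 0 else x.coord j, l, fun _ hj => if_pos hj.le⟩

theorem coord_tail (l : ℤ) (x : Vilenkin p) (j : ℤ) :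
    (tail l x).coord j = if j ≤ l then 0 else x.coord j := rfl

theorem tail_mem_U (l : ℤ) (x : Vilenkin p) : tail l x ∈ U p l := fun j hj => by
  rw [coord_tail, if_pos hj]

theorem sub_tail_mem_L (l : ℤ) (x : Vilenkin p) : x - tail l x ∈ L p l := fun j hj => by
  rw [coord_sub, coord_tail, if_neg (by omega), sub_self]

theorem isAddFundamentalDomain_U [NeZero p] (l : ℤ) :
    IsAddFundamentalDomain (L p l) (U p l : Set (Vilenkin p)) (haar p) := by
  refine IsAddFundamentalDomain.mk' (measurableSet_U l).nullMeasurableSet fun x => ?_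
  -- The translation that brings `x` into `U_l` removes its part in `L_l`.
  refine ⟨-⟨x - tail l x, sub_tail_mem_L l x⟩, ?_, fun g hg => ?_⟩
  · change -(x - tail l x) + x ∈ U p l
    simpa using tail_mem_U l x
  · have hg : (g : Vilenkin p) + x ∈ U p l := hg
    have h : (g : Vilenkin p) + (x - tail l x) = 0 := by
      refine eq_zero_of_mem_L_of_mem_U ((L p l).add_mem g.2 (sub_tail_mem_L l x)) ?_
      rw [← add_sub_assoc]
      exact (U p l).sub_mem hg (tail_mem_U l x)
    exact Subtype.ext (eq_neg_of_add_eq_zero_left h)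

theorem Hperp_eq [NeZero p] : Hperp p = (L p 0 : Set (Dual p)) := by
  ext ω
  constructor
  · intro h j hj
    refine coord_eq_zero_of_χ_single (h _ fun i hi => ?_)
    rw [coord_single, Pi.single_eq_of_ne (by omega)]
  · intro h x hx
    have h0 : ∀ j : ℤ, x.coord j * ω.coord (1 - j) = 0 := fun j => by
      rcases le_or_gt j 0 with hj | hj
      · simp [h (1 - j) (by omega)]
      · simp [hx j hj]
    rw [χ, finsum_eq_zero_of_forall_eq_zero h0, AddChar.map_zero_eq_one]

end Discrete

/-! ### Haar measure of `U_l` -/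

section HaarMeasure

variable [NeZero p]

theorem haar_U_zero : haar p (U p 0 : Set (Vilenkin p)) = 1 :=
  Measure.addHaarMeasure_self (K₀ := unitCompact p)

omit [NeZero p] in
theorem U_eq_iUnion (l : ℤ) :
    (U p l : Set (Vilenkin p)) = ⋃ a : ZMod p, single (l + 1) a +ᵥ (U p (l + 1) : Set _) := by
  ext x
  simp only [Set.mem_iUnion, Set.mem_vadd_set_iff_neg_vadd_mem, vadd_eq_add, SetLike.mem_coe]
  constructor
  · intro hx
    refine ⟨x.coord (l + 1), fun j hj => ?_⟩
    rw [coord_add, coord_neg, coord_single]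
    rcases eq_or_ne j (l + 1) with rfl | hj'
    · simp
    · rw [Pi.single_eq_of_ne hj', hx j (by omega)]
      simp
  · rintro ⟨a, ha⟩
    have h := (U p l).add_mem (single_mem_U (lt_add_one l) a) (U_anti (lt_add_one l).le ha)
    simpa using h

theorem haar_U_succ (l : ℤ) :
    haar p (U p l : Set (Vilenkin p)) = p * haar p (U p (l + 1) : Set (Vilenkin p)) := by
  rw [U_eq_iUnion, measure_iUnion]
  · simp [measure_vadd, tsum_fintype, ZMod.card]
  · intro a b hab
    refine Set.disjoint_left.2 fun x ha hb => hab ?_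
    rw [Set.mem_vadd_set_iff_neg_vadd_mem] at ha hb
    have ha' := ha (l + 1) le_rfl
    have hb' := hb (l + 1) le_rfl
    simp only [vadd_eq_add, coord_add, coord_neg, coord_single, Pi.single_eq_same] at ha' hb'
    exact neg_injective (add_right_cancel (ha'.trans hb'.symm))
  · exact fun a => (measurableSet_U _).const_vadd _

theorem haar_U (l : ℤ) : haar p (U p l : Set (Vilenkin p)) = (p : ℝ≥0∞) ^ (-l) := by
  have hp : (p : ℝ≥0∞) ≠ 0 := Nat.cast_ne_zero.2 (NeZero.ne p)
  have ht : (p : ℝ≥0∞) ≠ ∞ := ENNReal.natCast_ne_top p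
  induction l with
  | zero => simpa using haar_U_zero
  | succ i ih =>
    rw [haar_U_succ, show -(i : ℤ) = 1 + -((i : ℤ) + 1) by ring, ENNReal.zpow_add hp ht,
      zpow_one] at ih
    exact (ENNReal.mul_right_inj hp ht).1 ih
  | pred i ih =>
    rw [haar_U_succ, sub_add_cancel, ih, show -(-(i : ℤ) - 1) = 1 + - -(i : ℤ) by ring,
      ENNReal.zpow_add hp ht, zpow_one]

theorem haar_U_ne_top (l : ℤ) : haar p (U p l : Set (Vilenkin p)) ≠ ∞ := by
  rw [haar_U]
  exact (ENNReal.zpow_lt_top (Nat.cast_ne_zero.2 (NeZero.ne p)) (ENNReal.natCast_ne_top p) _).ne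

/-- This duality of measures makes the constant in the Fourier bound exactly 1. -/
theorem haar_U_mul_haar_U_neg (l : ℤ) :
    haar p (U p l : Set (Vilenkin p)) * haar p (U p (-l) : Set (Vilenkin p)) = 1 := by
  rw [haar_U, haar_U, ← ENNReal.zpow_add (Nat.cast_ne_zero.2 (NeZero.ne p))
    (ENNReal.natCast_ne_top p), neg_neg, neg_add_cancel, zpow_zero]

end HaarMeasure

end Vilenkin

/-! ### Truncated Fourier integrals as contractions of `L²` -/

namespace Vilenkin

variable {p : ℕ} [NeZero p]

theorem setIntegral_U_add_right {l : ℤ} {u : Vilenkin p} (hu : u ∈ U p l) (f : Vilenkin p → ℂ) :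
    ∫ x in (U p l : Set (Vilenkin p)), f (x + u) ∂(haar p) =
      ∫ x in (U p l : Set (Vilenkin p)), f x ∂(haar p) := by
  rw [← integral_indicator (measurableSet_U l), ← integral_indicator (measurableSet_U l),
    ← integral_add_right_eq_self ((U p l : Set (Vilenkin p)).indicator f) u]
  congr 1 with x
  have h : x + u ∈ (U p l : Set (Vilenkin p)) ↔ x ∈ (U p l : Set (Vilenkin p)) :=
    (U p l).add_mem_cancel_right hu
  by_cases hx : x ∈ (U p l : Set (Vilenkin p))
  · rw [Set.indicator_of_mem hx, Set.indicator_of_mem (h.2 hx)]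
  · rw [Set.indicator_of_notMem hx, Set.indicator_of_notMem (mt h.1 hx)]

/-- Translating by some `u ∈ U_l` with `χ(u, ω) ≠ 1` preserves the integral yet multiplies it by
`χ(u, ω)`. -/
theorem setIntegral_χ_of_notMem {l : ℤ} {ω : Dual p} (hω : ω ∉ U p (-l)) :
    ∫ x in (U p l : Set (Vilenkin p)), χ x ω ∂(haar p) = 0 := by
  obtain ⟨u, hu, hne⟩ := exists_χ_ne_one hω
  rw [neg_neg] at hu
  have h := setIntegral_U_add_right hu fun x => χ x ω
  simp only [χ_add_left] at h
  rw [integral_mul_const] at h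
  by_contra h0
  exact hne (mul_left_cancel₀ h0 (h.trans (mul_one _).symm))

theorem memLp_indicator_χ (l : ℤ) (ω : Dual p) :
    MemLp ((U p l : Set (Vilenkin p)).indicator fun x => χ x ω) 2 (haar p) := by
  rw [memLp_indicator_iff_restrict (measurableSet_U l)]
  have : IsFiniteMeasure ((haar p).restrict (U p l : Set (Vilenkin p))) :=
    ⟨by simpa using (haar_U_ne_top l).lt_top⟩
  exact MemLp.of_bound (continuous_χ_left ω).aestronglyMeasurable 1
    (Eventually.of_forall fun x => (norm_χ x ω).le)

/-- The restriction of the character `χ(·, ω)` to `U_{-n}`, as an element of `L²`. -/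
noncomputable def charL2 (n : ℕ) (ω : Dual p) : L2 p := (memLp_indicator_χ (-(n : ℤ)) ω).toLp _

theorem inner_charL2 (n : ℕ) (ω : Dual p) (f : L2 p) :
    inner ℂ (charL2 n ω) f = truncatedFourier n f ω := by
  rw [L2.inner_def, truncatedFourier, ← integral_indicator (measurableSet_U _)]
  refine integral_congr_ae ?_
  filter_upwards [(memLp_indicator_χ (-(n : ℤ)) ω).coeFn_toLp] with x hx
  rw [charL2, hx, RCLike.inner_apply]
  by_cases h : x ∈ (U p (-(n : ℤ)) : Set (Vilenkin p)) <;> simp [h]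

theorem inner_charL2_charL2 (n : ℕ) (ω ν : Dual p) :
    inner ℂ (charL2 n ω) (charL2 n ν) =
      ∫ x in (U p (-(n : ℤ)) : Set (Vilenkin p)), χ x (ν - ω) ∂(haar p) := by
  rw [inner_charL2, truncatedFourier]
  refine setIntegral_congr_ae (measurableSet_U _) ?_
  filter_upwards [(memLp_indicator_χ (-(n : ℤ)) ν).coeFn_toLp] with x hx hU
  rw [charL2, hx, Set.indicator_of_mem hU, χ_sub_right, mul_comm]

/-- `L_n` represents the cosets of `U_n`, the annihilator of `U_{-n}`, so distinct indices give
distinct characters on `U_{-n}`, which are orthogonal. -/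
theorem orthonormal_charL2 (n : ℕ) :
    Orthonormal ℂ fun h : L p (n : ℤ) =>
      ((√((haar p).real (U p (-(n : ℤ)) : Set (Vilenkin p))))⁻¹ : ℂ) • charL2 n (h : Dual p) := by
  have hpos : 0 < (haar p).real (U p (-(n : ℤ)) : Set (Vilenkin p)) :=
    ENNReal.toReal_pos (by
      intro h
      have := haar_U_mul_haar_U_neg (p := p) (-(n : ℤ))
      simp [h] at this) (haar_U_ne_top _)
  classical
  rw [orthonormal_iff_ite]
  intro h k
  rw [inner_smul_left, inner_smul_right, inner_charL2_charL2]
  split_ifs with hk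
  · subst hk
    have h1 : ∀ x : Vilenkin p, χ x 0 = 1 := fun x => by simp [χ]
    simp only [sub_self, h1]
    rw [setIntegral_const, map_inv₀, Complex.conj_ofReal, Complex.real_smul, mul_one,
      ← mul_assoc, ← mul_inv, ← Complex.ofReal_mul, Real.mul_self_sqrt hpos.le, inv_mul_cancel₀]
    exact_mod_cast hpos.ne'
  · rw [setIntegral_χ_of_notMem, mul_zero, mul_zero]
    rw [neg_neg]
    intro hU
    refine hk (Subtype.ext (sub_eq_zero.1 ?_).symm)
    exact eq_zero_of_mem_L_of_mem_U ((L p n).sub_mem k.2 h.2) hU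

theorem tsum_enorm_truncatedFourier_sq_le (n : ℕ) (f : L2 p) :
    ∑' h : L p (n : ℤ), ‖truncatedFourier n f h‖ₑ ^ 2 ≤
      haar p (U p (-(n : ℤ)) : Set (Vilenkin p)) * ‖f‖ₑ ^ 2 := by
  have hpos : 0 < (haar p).real (U p (-(n : ℤ)) : Set (Vilenkin p)) :=
    ENNReal.toReal_pos (by
      intro h
      have := haar_U_mul_haar_U_neg (p := p) (-(n : ℤ))
      simp [h] at this) (haar_U_ne_top _)
  rw [ENNReal.tsum_eq_iSup_sum]
  refine iSup_le fun s => ?_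
  have h := (orthonormal_charL2 (p := p) n).sum_inner_products_le f (s := s)
  simp only [inner_smul_left, inner_charL2, norm_mul, mul_pow, ← Finset.mul_sum] at h
  rw [map_inv₀, Complex.conj_ofReal, norm_inv, Complex.norm_real, Real.norm_of_nonneg (by positivity),
    inv_pow, Real.sq_sqrt hpos.le, inv_mul_le_iff₀ hpos] at h
  have h' := ENNReal.ofReal_le_ofReal h
  rw [ENNReal.ofReal_mul hpos.le, ENNReal.ofReal_sum_of_nonneg fun _ _ => by positivity,
    ofReal_measureReal (haar_U_ne_top _), ENNReal.ofReal_pow (norm_nonneg _), ofReal_norm] at h'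
  simpa only [ENNReal.ofReal_pow (norm_nonneg _), ofReal_norm] using h'

theorem truncatedFourier_add_of_mem_U (n : ℕ) (f : Vilenkin p → ℂ) (ω : Dual p) {u : Dual p}
    (hu : u ∈ U p (n : ℤ)) : truncatedFourier n f (ω + u) = truncatedFourier n f ω := by
  refine setIntegral_congr_fun (measurableSet_U _) fun x hx => ?_
  rw [χ_add_right, χ_eq_one (ω := u) hx (by simpa using hu), mul_one]

theorem continuous_truncatedFourier (n : ℕ) (f : Vilenkin p → ℂ) :
    Continuous (truncatedFourier n f) :=
  continuous_of_forall_add n fun ω _ hu => truncatedFourier_add_of_mem_U n f ω hu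

/-- The integrand is constant on cosets of `U_n`, so the integral is the sum over `L_n` times the
measure of `U_n`. Bessel's inequality bounds the sum, and the measures of `U_n` and `U_{-n}` cancel.
-/
theorem lintegral_enorm_truncatedFourier_sq_le (n : ℕ) (f : L2 p) :
    ∫⁻ ω, ‖truncatedFourier n f ω‖ₑ ^ 2 ∂(haar p) ≤ ‖f‖ₑ ^ 2 := by
  rw [(isAddFundamentalDomain_U (p := p) (n : ℤ)).lintegral_eq_tsum'']
  have h : ∀ g : L p (n : ℤ), ∫⁻ x in (U p (n : ℤ) : Set (Dual p)),
      ‖truncatedFourier n f (g +ᵥ x)‖ₑ ^ 2 ∂(haar p) =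
        ‖truncatedFourier n f g‖ₑ ^ 2 * haar p (U p (n : ℤ) : Set (Dual p)) := fun g => by
    rw [← setLIntegral_const]
    refine setLIntegral_congr_fun (measurableSet_U _) fun x hx => ?_
    change ‖truncatedFourier n f ((g : Dual p) + x)‖ₑ ^ 2 = _
    rw [truncatedFourier_add_of_mem_U n f _ hx]
  rw [tsum_congr h, ENNReal.tsum_mul_right]
  refine (mul_le_mul_left (tsum_enorm_truncatedFourier_sq_le n f) _).trans_eq ?_
  rw [mul_right_comm, mul_comm (haar p _), haar_U_mul_haar_U_neg, one_mul]

theorem eLpNorm_two_eq {α : Type*} [MeasurableSpace α] (μ : Measure α) (f : α → ℂ) :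
    eLpNorm f 2 μ = (∫⁻ x, ‖f x‖ₑ ^ 2 ∂μ) ^ (1 / 2 : ℝ) := by
  rw [eLpNorm_eq_lintegral_rpow_enorm_toReal two_ne_zero ENNReal.ofNat_ne_top]
  simp

theorem eLpNorm_truncatedFourier_le (n : ℕ) (f : L2 p) :
    eLpNorm (truncatedFourier n f) 2 (haar p) ≤ ‖f‖ₑ := by
  rw [eLpNorm_two_eq]
  refine (ENNReal.rpow_le_rpow (lintegral_enorm_truncatedFourier_sq_le n f)
    (by norm_num : (0 : ℝ) ≤ 1 / 2)).trans_eq ?_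
  rw [← ENNReal.rpow_natCast, ← ENNReal.rpow_mul]
  norm_num

theorem memLp_truncatedFourier (n : ℕ) (f : L2 p) :
    MemLp (truncatedFourier n f) 2 (haar p) :=
  ⟨(continuous_truncatedFourier n f).aestronglyMeasurable,
    (eLpNorm_truncatedFourier_le n f).trans_lt enorm_lt_top⟩

/-- The truncated Fourier integral as a contraction of `L²`. -/
noncomputable def truncatedFourierCLM (p : ℕ) [NeZero p] (n : ℕ) : L2 p →L[ℂ] L2 p :=
  LinearMap.mkContinuous
    { toFun := fun f => (memLp_truncatedFourier n f).toLp _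
      map_add' := fun f g => by
        rw [← MemLp.toLp_add]
        refine MemLp.toLp_congr _ _ (Eventually.of_forall fun ω => ?_)
        simp only [← inner_charL2, Pi.add_apply, inner_add_right]
      map_smul' := fun c f => by
        rw [RingHom.id_apply, ← MemLp.toLp_const_smul]
        refine MemLp.toLp_congr _ _ (Eventually.of_forall fun ω => ?_)
        simp only [← inner_charL2, Pi.smul_apply, inner_smul_right, smul_eq_mul] }
    1 fun f => by
      rw [one_mul, ← enorm_le_iff_norm_le]
      exact (Lp.enorm_toLp (memLp_truncatedFourier n f)).trans_le (eLpNorm_truncatedFourier_le n f)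

theorem truncatedFourierCLM_apply (n : ℕ) (f : L2 p) :
    truncatedFourierCLM p n f = (memLp_truncatedFourier n f).toLp _ := rfl

theorem norm_truncatedFourierCLM_apply_le (n : ℕ) (f : L2 p) :
    ‖truncatedFourierCLM p n f‖ ≤ ‖f‖ :=
  ((truncatedFourierCLM p n).le_of_opNorm_le (LinearMap.mkContinuous_norm_le _ zero_le_one _)
    f).trans_eq (one_mul _)

theorem isFourier_iff (f g : L2 p) :
    IsFourier f g ↔ Tendsto (fun n => truncatedFourierCLM p n f) atTop (𝓝 g) := by
  rw [Lp.tendsto_Lp_iff_tendsto_eLpNorm', IsFourier]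
  refine iff_of_eq (congrArg (fun u => Tendsto u atTop (𝓝 0)) (funext fun n => ?_))
  refine eLpNorm_congr_ae ?_
  filter_upwards [(memLp_truncatedFourier n f).coeFn_toLp] with ω hω
  rw [Pi.sub_apply, truncatedFourierCLM_apply, hω]

/-! ### Existence of the `L²` Fourier transform -/

/-- The product of `f` with the indicator function of `U_{-n}`. -/
noncomputable def cutL2 (n : ℕ) (f : L2 p) : L2 p :=
  ((Lp.memLp f).indicator (measurableSet_U (-(n : ℤ)))).toLp _

theorem coeFn_cutL2 (n : ℕ) (f : L2 p) :
    cutL2 n f =ᵐ[haar p] (U p (-(n : ℤ)) : Set (Vilenkin p)).indicator f :=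
  MemLp.coeFn_toLp _

theorem tendsto_cutL2 (f : L2 p) : Tendsto (fun n => cutL2 n f) atTop (𝓝 f) := by
  rw [Lp.tendsto_Lp_iff_tendsto_eLpNorm']
  have h : ∀ n, eLpNorm (⇑(cutL2 n f) - ⇑f) 2 (haar p) =
      (∫⁻ x, ‖(U p (-(n : ℤ)) : Set (Vilenkin p)).indicator f x - f x‖ₑ ^ 2 ∂(haar p)) ^
        (1 / 2 : ℝ) := fun n => by
    rw [← eLpNorm_two_eq]
    refine eLpNorm_congr_ae ?_
    filter_upwards [coeFn_cutL2 n f] with x hx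
    rw [Pi.sub_apply, hx]
  simp only [h]
  have hlim : Tendsto (fun n : ℕ =>
      ∫⁻ x, ‖(U p (-(n : ℤ)) : Set (Vilenkin p)).indicator f x - f x‖ₑ ^ 2 ∂(haar p)) atTop
      (𝓝 (∫⁻ _, 0 ∂(haar p))) := by
    have hf : AEStronglyMeasurable f (haar p) := (Lp.memLp f).1
    refine tendsto_lintegral_of_dominated_convergence' (fun x => ‖f x‖ₑ ^ 2)
      (fun n => (((hf.indicator (measurableSet_U _)).sub hf).enorm.pow_const 2))
      (fun n => Eventually.of_forall fun x => ?_) ?_ (Eventually.of_forall fun x => ?_)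
    · by_cases hx : x ∈ (U p (-(n : ℤ)) : Set (Vilenkin p)) <;> simp [hx]
    · intro htop
      have := eLpNorm_two_eq (haar p) f
      rw [htop, ENNReal.top_rpow_of_pos (by norm_num)] at this
      exact (Lp.memLp f).2.ne this
    · refine tendsto_const_nhds.congr' ?_
      filter_upwards [eventually_mem_U x] with n hn
      rw [Set.indicator_of_mem (show x ∈ (U p (-(n : ℤ)) : Set (Vilenkin p)) from hn)]
      simp
  rw [lintegral_zero] at hlim
  have := hlim.ennrpow_const (1 / 2 : ℝ)
  rwa [ENNReal.zero_rpow_of_pos (by norm_num)] at this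

theorem truncatedFourierCLM_cutL2 {m n : ℕ} (h : m ≤ n) (f : L2 p) :
    truncatedFourierCLM p n (cutL2 m f) = truncatedFourierCLM p m f := by
  rw [truncatedFourierCLM_apply, truncatedFourierCLM_apply]
  refine MemLp.toLp_congr _ _ (Eventually.of_forall fun ω => ?_)
  have hU : (U p (-(m : ℤ)) : Set (Vilenkin p)) ⊆ U p (-(n : ℤ)) :=
    SetLike.coe_subset_coe.2 (U_anti (by omega))
  rw [truncatedFourier, truncatedFourier, ← Set.inter_eq_right.2 hU,
    ← setIntegral_indicator (measurableSet_U _)]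
  refine integral_congr_ae (ae_restrict_of_ae ?_)
  filter_upwards [coeFn_cutL2 m f] with x hx
  rw [hx]
  by_cases hx : x ∈ (U p (-(m : ℤ)) : Set (Vilenkin p)) <;> simp [hx]

theorem exists_isFourier (f : L2 p) : ∃ g, IsFourier f g := by
  simp only [isFourier_iff]
  -- For `m ≤ n`, the `m`-th term is the `n`-th truncated transform of `cutL2 m f`, so contractivity
  -- bounds its distance to the `n`-th term by `dist f (cutL2 m f)`.
  refine cauchySeq_tendsto_of_complete
    (cauchySeq_of_le_tendsto_0' (fun m => dist f (cutL2 m f)) (fun m n hmn => ?_) ?_)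
  · rw [dist_comm, ← truncatedFourierCLM_cutL2 hmn, dist_eq_norm, dist_eq_norm, ← map_sub]
    exact norm_truncatedFourierCLM_apply_le n _
  · simpa using tendsto_const_nhds.dist (tendsto_cutL2 f) (a := f)

theorem isFourier_fourier (f : L2 p) : IsFourier f (fourier f) := by
  rw [fourier, dif_pos (exists_isFourier f)]
  exact (exists_isFourier f).choose_spec

theorem tendsto_truncatedFourierCLM (f : L2 p) :
    Tendsto (fun n => truncatedFourierCLM p n f) atTop (𝓝 (fourier f)) :=
  (isFourier_iff f _).1 (isFourier_fourier f)

/-- The Fourier transform as a contraction of `L²`. -/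
noncomputable def fourierCLM (p : ℕ) [NeZero p] : L2 p →L[ℂ] L2 p :=
  LinearMap.mkContinuous
    { toFun := fourier
      map_add' := fun f g => tendsto_nhds_unique (tendsto_truncatedFourierCLM (f + g)) <| by
        simpa only [map_add] using
          (tendsto_truncatedFourierCLM f).add (tendsto_truncatedFourierCLM g)
      map_smul' := fun c f => tendsto_nhds_unique (tendsto_truncatedFourierCLM (c • f)) <| by
        simpa only [map_smul, RingHom.id_apply] using (tendsto_truncatedFourierCLM f).const_smul c }
    1 fun f => by
      rw [one_mul]
      exact le_of_tendsto (tendsto_truncatedFourierCLM f).norm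
        (Eventually.of_forall fun n => norm_truncatedFourierCLM_apply_le n f)

end Vilenkin

/-! ### Translations, fibres and the spectrum -/

namespace Vilenkin

variable {p : ℕ} [NeZero p]

theorem truncatedFourier_translate {n : ℕ} {h : Vilenkin p} (hn : h ∈ U p (-(n : ℤ)))
    (f : L2 p) (ω : Dual p) :
    truncatedFourier n (translate h f) ω = conj (χ h ω) * truncatedFourier n f ω := by
  have hT : truncatedFourier n (translate h f) ω =
      ∫ x in (U p (-(n : ℤ)) : Set (Vilenkin p)), f (x - h) * conj (χ x ω) ∂(haar p) := by
    refine integral_congr_ae (ae_restrict_of_ae ?_)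
    filter_upwards [Lp.coeFn_compMeasurePreserving f (measurePreserving_sub_right (haar p) h)]
      with x hx
    rw [translate, hx, Function.comp_apply]
  rw [hT, ← setIntegral_U_add_right hn, truncatedFourier, ← integral_const_mul]
  congr 1 with x
  rw [add_sub_cancel_right, χ_add_left, map_mul]
  ring

theorem memLp_conj_χ_mul (h : Vilenkin p) (g : L2 p) :
    MemLp (fun ω => conj (χ h ω) * g ω) 2 (haar p) :=
  (Lp.memLp g).congr_norm
    ((Complex.continuous_conj.comp (continuous_χ_right h)).aestronglyMeasurable.mul
      (Lp.memLp g).1)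
    (Eventually.of_forall fun ω => by simp)

/-- The Fourier transform turns the translation by `h` into the multiplication by
`conj χ(h, ·)`. -/
theorem fourier_translate (h : Vilenkin p) (f : L2 p) :
    fourier (translate h f) =ᵐ[haar p] fun ω => conj (χ h ω) * fourier f ω := by
  have hF : IsFourier (translate h f) ((memLp_conj_χ_mul h (fourier f)).toLp _) := by
    refine (isFourier_fourier f).congr' ?_
    -- Once `U_{-n}` contains `h`, translation by `h` preserves it and the identity is exact; the
    -- unimodular factor then leaves the norm unchanged.
    filter_upwards [eventually_mem_U h] with n hn
    refine eLpNorm_congr_norm_ae ?_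
    filter_upwards [(memLp_conj_χ_mul h (fourier f)).coeFn_toLp] with ω hω
    rw [hω, truncatedFourier_translate hn, ← mul_sub, norm_mul, RCLike.norm_conj, norm_χ, one_mul]
  rw [tendsto_nhds_unique (tendsto_truncatedFourierCLM _) ((isFourier_iff _ _).1 hF)]
  exact MemLp.coeFn_toLp _

/-- The closed subspace of all `f` whose Fourier transform vanishes almost everywhere on `Z`. -/
noncomputable def vanishing (Z : Set (Dual p)) : Submodule ℂ (L2 p) :=
  ((LpToLpRestrictCLM (Dual p) ℂ ℂ (haar p) 2 Z).comp (fourierCLM p)).ker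

theorem isClosed_vanishing (Z : Set (Dual p)) : IsClosed (vanishing Z : Set (L2 p)) :=
  ((LpToLpRestrictCLM (Dual p) ℂ ℂ (haar p) 2 Z).comp (fourierCLM p)).isClosed_ker

theorem mem_vanishing {Z : Set (Dual p)} {f : L2 p} :
    f ∈ vanishing Z ↔ ∀ᵐ ω ∂(haar p), ω ∈ Z → fourier f ω = 0 := by
  have hm : MeasurableSet {ω | fourier f ω = 0} :=
    (Lp.stronglyMeasurable (fourier f)).measurable (measurableSet_singleton 0)
  -- `Z` may be non-measurable: only the zero set of the transform has to be measurable here.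
  rw [← ae_restrict_iff hm, vanishing, LinearMap.mem_ker]
  have h := LpToLpRestrictCLM_coeFn (μ := haar p) (p := 2) ℂ Z (fourier f)
  change LpToLpRestrictCLM (Dual p) ℂ ℂ (haar p) 2 Z (fourier f) = 0 ↔ _
  rw [Lp.eq_zero_iff_ae_eq_zero]
  exact ⟨fun h0 => h.symm.trans h0, fun h0 => h.trans h0⟩

theorem principal_le_vanishing {φ : L2 p} {Z : Set (Dual p)} (h : φ ∈ vanishing Z) :
    principal φ ≤ vanishing Z := by
  refine Submodule.topologicalClosure_minimal _ (Submodule.span_le.2 ?_) (isClosed_vanishing Z)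
  rintro _ ⟨x, -, rfl⟩
  refine mem_vanishing.2 ?_
  filter_upwards [fourier_translate x φ, mem_vanishing.1 h] with ω hω h0 hZ
  rw [hω, h0 hZ, mul_zero]

theorem translate_zero (f : L2 p) : translate 0 f = f := by
  refine Lp.ext ?_
  filter_upwards [Lp.coeFn_compMeasurePreserving f (measurePreserving_sub_right (haar p) 0)]
    with x hx
  rw [translate, hx, Function.comp_apply, sub_zero]

theorem self_mem_principal (φ : L2 p) : φ ∈ principal φ :=
  Submodule.le_topologicalClosure _
    (Submodule.subset_span ⟨0, fun _ _ => rfl, translate_zero φ⟩)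

instance : Countable (Hperp p) := by
  rw [Hperp_eq]
  exact inferInstanceAs (Countable (L p 0))

theorem zero_mem_Hperp : (0 : Dual p) ∈ Hperp p := by
  rw [Hperp_eq]
  exact (L p 0).zero_mem

theorem add_mem_Hperp {h k : Dual p} (hh : h ∈ Hperp p) (hk : k ∈ Hperp p) : h + k ∈ Hperp p := by
  rw [Hperp_eq] at *
  exact (L p 0).add_mem hh hk

theorem fiber_eq_zero_iff {g : Dual p → ℂ} {ω : Dual p} :
    fiber g ω = 0 ↔ ∀ h ∈ Hperp p, g (ω + h) = 0 :=
  ⟨fun H h hh => congrFun H ⟨h, hh⟩, fun H => funext fun h => H h h.2⟩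

theorem eq_zero_of_fiber_eq_zero {g : Dual p → ℂ} {ω : Dual p} (h : fiber g ω = 0) : g ω = 0 := by
  simpa using fiber_eq_zero_iff.1 h 0 zero_mem_Hperp

theorem fiber_add_eq_zero {g : Dual p → ℂ} {ω h : Dual p} (hh : h ∈ Hperp p)
    (hω : fiber g ω = 0) : fiber g (ω + h) = 0 :=
  fiber_eq_zero_iff.2 fun k hk => by
    rw [add_assoc]
    exact fiber_eq_zero_iff.1 hω _ (add_mem_Hperp hh hk)

theorem ae_add_right {P : Vilenkin p → Prop} (h : Vilenkin p) (hP : ∀ᵐ x ∂(haar p), P x) :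
    ∀ᵐ x ∂(haar p), P (x + h) := by
  have ht : Tendsto (fun x => x + h) (ae (haar p)) (ae (haar p)) :=
    (measurePreserving_add_right (haar p) h).quasiMeasurePreserving.tendsto_ae
  exact ht.eventually hP

/-- A function which vanishes almost everywhere on an `H^⊥`-invariant set has zero fibres at
almost every point of this set. -/
theorem ae_fiber_eq_zero {Z : Set (Dual p)} (hZ : ∀ ω ∈ Z, ∀ h ∈ Hperp p, ω + h ∈ Z)
    {g : Dual p → ℂ} (hg : ∀ᵐ ω ∂(haar p), ω ∈ Z → g ω = 0) :
    ∀ᵐ ω ∂(haar p), ω ∈ Z → fiber g ω = 0 := by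
  have h : ∀ᵐ ω ∂(haar p), ∀ h : Hperp p, ω + (h : Dual p) ∈ Z → g (ω + (h : Dual p)) = 0 :=
    -- Countability of `H^⊥` lets one null set serve all translates.
    ae_all_iff.2 fun h => ae_add_right (P := fun ω => ω ∈ Z → g ω = 0) h.1 hg
  filter_upwards [h] with ω hω hωZ
  exact funext fun h => hω h (hZ ω hωZ h h.2)

/-- With `f = φ` this also compares two representatives of the same transform. -/
theorem fiberSupport_ae_le {φ f : L2 p} {φhat g : Dual p → ℂ}
    (hφ : φhat =ᵐ[haar p] fourier φ) (hf : f ∈ principal φ) (hg : g =ᵐ[haar p] fourier f) :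
    fiberSupport g ≤ᵐ[haar p] fiberSupport φhat := by
  have h0 : φ ∈ vanishing {ω | fiber φhat ω = 0} := by
    refine mem_vanishing.2 ?_
    filter_upwards [hφ] with ω hω hZ
    rw [← hω]
    exact eq_zero_of_fiber_eq_zero hZ
  have h1 : ∀ᵐ ω ∂(haar p), ω ∈ {ω | fiber φhat ω = 0} → g ω = 0 := by
    filter_upwards [hg, mem_vanishing.1 (principal_le_vanishing h0 hf)] with ω hω h2 hZ
    rw [hω, h2 hZ]
  filter_upwards [ae_fiber_eq_zero (Z := {ω | fiber φhat ω = 0})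
    (fun ω hω h hh => fiber_add_eq_zero hh hω) h1] with ω hω
  exact fun h => ⟨h.1, fun h2 => h.2 (hω h2)⟩

theorem fiberSupport_ae_le_of_dense {φ : L2 p} {φhat : Dual p → ℂ}
    (hφ : φhat =ᵐ[haar p] fourier φ) {D : Set (L2 p)}
    (hD : (principal φ : Set (L2 p)) ⊆ closure D) {r : L2 p → Dual p → ℂ}
    (hr : ∀ f ∈ D, r f =ᵐ[haar p] fourier f) :
    fiberSupport φhat ≤ᵐ[haar p]
      ({ω | ω ∈ U p 0 ∧ ∃ f ∈ D, fiber (r f) ω ≠ 0} : Set (Dual p)) := by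
  let Z : Set (Dual p) := {ω | ∀ f ∈ D, fiber (r f) ω = 0}
  have hDZ : D ⊆ vanishing Z := fun f hf => by
    refine mem_vanishing.2 ?_
    filter_upwards [hr f hf] with ω hω hZ
    rw [← hω]
    exact eq_zero_of_fiber_eq_zero (hZ f hf)
  have h0 : φ ∈ vanishing Z :=
    closure_minimal hDZ (isClosed_vanishing Z) (hD (self_mem_principal φ))
  have h1 : ∀ᵐ ω ∂(haar p), ω ∈ Z → φhat ω = 0 := by
    filter_upwards [hφ, mem_vanishing.1 h0] with ω hω h2 hZ
    rw [hω, h2 hZ]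
  filter_upwards [ae_fiber_eq_zero (Z := Z)
    (fun ω hω h hh f hf => fiber_add_eq_zero hh (hω f hf)) h1] with ω hω h
  refine ⟨h.1, ?_⟩
  by_contra! hne
  exact h.2 (hω hne)

/-- Nonemptiness matters: for empty `D` the set of fibres is `∅`, which differs from `{0}`. -/
theorem fibers_ne_singleton_zero_iff {D : Set (L2 p)} (hD : D.Nonempty) {r : L2 p → Dual p → ℂ}
    {ω : Dual p} : fibers r D ω ≠ {0} ↔ ∃ f ∈ D, fiber (r f) ω ≠ 0 := by
  rw [Ne, fibers, (hD.image _).subset_singleton_iff.symm, Set.image_subset_iff, Set.not_subset]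
  rfl

theorem fiberSupport_eq (g : Dual p → ℂ) :
    fiberSupport g = Function.support (periodization g) ∩ U p 0 := by
  ext ω
  have h : periodization g ω = 0 ↔ fiber g ω = 0 := by
    simp [periodization, ENNReal.tsum_eq_zero, fiber_eq_zero_iff]
  exact ⟨fun hω => ⟨fun h0 => hω.2 (h.1 h0), hω.1⟩, fun hω => ⟨hω.2, fun h0 => hω.1 (h.2 h0)⟩⟩

end Vilenkin

theorem mainTheorem4 (p : ℕ) [NeZero p] (φ : Vilenkin.L2 p)
    (φhat : Vilenkin.Dual p → ℂ) (hφ : φhat =ᵐ[Vilenkin.haar p] Vilenkin.fourier φ) :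
    (∀ E : Set (Vilenkin.Dual p), E ⊆ Vilenkin.U p 0 →
      (Vilenkin.IsSpectrum (Vilenkin.principal φ) E ↔
        E =ᵐ[Vilenkin.haar p] Vilenkin.fiberSupport φhat)) ∧
    (∀ D : Set (Vilenkin.L2 p), D.Countable → D ⊆ Vilenkin.principal φ →
      (Vilenkin.principal φ : Set (Vilenkin.L2 p)) ⊆ closure D →
      ∀ r : Vilenkin.L2 p → Vilenkin.Dual p → ℂ,
      (∀ f ∈ D, r f =ᵐ[Vilenkin.haar p] Vilenkin.fourier f) →
      ({ω | ω ∈ Vilenkin.U p 0 ∧ Vilenkin.fibers r D ω ≠ {0}} : Set (Vilenkin.Dual p))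
        =ᵐ[Vilenkin.haar p] Vilenkin.fiberSupport φhat) ∧
    Vilenkin.fiberSupport φhat =
      Function.support (Vilenkin.periodization φhat) ∩ Vilenkin.U p 0 := by
  refine ⟨fun E hE => ⟨fun h => ?_, fun h => ⟨hE, fun f hf => ?_, fun F hF => ?_⟩⟩,
    fun D hDc hDs hDd r hr => ?_, Vilenkin.fiberSupport_eq φhat⟩
  · refine EventuallyLE.antisymm (h.2.2 _ fun f hf => ?_) ?_
    · exact Vilenkin.fiberSupport_ae_le hφ hf EventuallyEq.rfl
    · exact (Vilenkin.fiberSupport_ae_le EventuallyEq.rfl (Vilenkin.self_mem_principal φ) hφ).trans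
        (h.2.1 φ (Vilenkin.self_mem_principal φ))
  · exact (Vilenkin.fiberSupport_ae_le hφ hf EventuallyEq.rfl).trans h.symm.le
  · exact h.le.trans ((Vilenkin.fiberSupport_ae_le EventuallyEq.rfl
      (Vilenkin.self_mem_principal φ) hφ).trans (hF φ (Vilenkin.self_mem_principal φ)))
  · have hne : D.Nonempty := closure_nonempty_iff.1 ⟨φ, hDd (Vilenkin.self_mem_principal φ)⟩
    simp only [Vilenkin.fibers_ne_singleton_zero_iff hne]
    refine EventuallyLE.antisymm ?_ (Vilenkin.fiberSupport_ae_le_of_dense hφ hDd hr)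
    -- Countability of `D` merges the exceptional null sets of its elements into one.
    have hall := (ae_ball_iff hDc).2 fun f hf =>
      Vilenkin.fiberSupport_ae_le hφ (hDs hf) (hr f hf)
    filter_upwards [hall] with ω hω
    rintro ⟨hU, f, hf, h⟩
    exact hω f hf ⟨hU, h⟩
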